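/- Let $X$ be a compact Hausdorff space (not necessarily second countable) and let $C(X)$ be the C*-algebra of complex continuous functions on $X$. A $C(X)$-algebra is a (not necessarily unital) C*-algebra $A$ endowed with a unital $*$-homomorphism from $C(X)$ into the center of the multiplier algebra $M(A)$; write $fa$ for the resulting product of $f\in C(X)$ and $a\in A$. For $x\in X$ let $A_x=A/C_x(X)A$ be the quotient of $A$ by the closed ideal $C_x(X)A$ generated by the products $fa$ with $a\in A$, $f\in C(X)$ and $f(x)=0$, and let $a_x$ be the image of $a\in A$ in $A_x$. The $C(X)$-algebra $A$ is a continuous field of C*-algebras over $X$ if the function $x\mapsto\|a_x\|$ is continuous on $X$ for every $a\in A$. For two $C(X)$-algebras $A$ and $B$, let $\mathcal I(A,B)$ be the involutive (two-sided, $*$-invariant) ideal of the algebraic tensor product $A\otimes_{alg}B$ over $\mathbb C$ generated by the elements $(fa)\otimes b-a\otimes(fb)$ with $f\in C(X)$, $a\in A$, $b\in B$, and let $\mathcal J(A,B)$ be the set of all $\alpha\in A\otimes_{alg}B$ whose image $\alpha_x$ in $A_x\otimes_{alg}B_x$ is zero for every $x\in X$. If $A$ is a continuous field of C*-algebras over $X$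 and $B$ is any $C(X)$-algebra, then $\mathcal I(A,B)=\mathcal J(A,B)$. -/

import Mathlib

open scoped TensorProduct MultiplierAlgebra

/-- A `C(X)`-algebra: a (not necessarily unital) C⋆-algebra `A` together with a unital
⋆-homomorphism from `C(X)` into the center of the multiplier algebra of `A`. -/
class CXAlgebra (X A : Type*) [TopologicalSpace X] [NonUnitalCStarAlgebra A] where
  /-- The structure morphism `C(X) → M(A)`. -/
  hom : C(X, ℂ) →⋆ₐ[ℂ] 𝓜(ℂ, A)
  /-- The structure morphism takes central values. -/
  hom_mem_center : ∀ f : C(X, ℂ), hom f ∈ Subalgebra.center ℂ 𝓜(ℂ, A)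

namespace CXAlgebra

noncomputable section

variable {X A B : Type*} [TopologicalSpace X]
  [NonUnitalCStarAlgebra A] [NonUnitalCStarAlgebra B]

/-- The product `f a` of `f ∈ C(X)` and `a ∈ A`: left multiplication of `a` by the multiplier
attached to `f`. -/
def act [CXAlgebra X A] (f : C(X, ℂ)) (a : A) : A :=
  (hom f : 𝓜(ℂ, A)).fst a

variable (A) in
/-- The closed ideal `C_x(X) A` of `A`, where `C_x(X)` is the set of functions vanishing at `x`:
the closed linear span of the products `f a` with `f(x) = 0`. -/
def fiberIdeal [CXAlgebra X A] (x : X) : Submodule ℂ A :=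
  (Submodule.span ℂ {c : A | ∃ (f : C(X, ℂ)) (a : A), f x = 0 ∧ c = act f a}).topologicalClosure

variable (A) in
/-- The fibre `A_x = A / C_x(X) A`, with the quotient norm. -/
abbrev Fiber [CXAlgebra X A] (x : X) : Type _ := A ⧸ fiberIdeal A x

variable (A) in
/-- The quotient map `A → A_x`, `a ↦ a_x`. -/
abbrev toFiber [CXAlgebra X A] (x : X) : A →ₗ[ℂ] Fiber A x := (fiberIdeal A x).mkQ

variable (X A) in
/-- `A` is a continuous field of C⋆-algebras over `X`: for every `a ∈ A` the function
`x ↦ ‖a_x‖` is continuous on `X`. -/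
def IsContinuousField [CXAlgebra X A] : Prop :=
  ∀ a : A, Continuous fun x : X => ‖toFiber A x a‖

/-- A linear subspace of the ⋆-algebra `A ⊗ B` is an involutive ideal if it is a two-sided ideal
stable under the involution. -/
structure IsInvolutiveIdeal (I : Submodule ℂ (A ⊗[ℂ] B)) : Prop where
  mul_left_mem : ∀ s t : A ⊗[ℂ] B, t ∈ I → s * t ∈ I
  mul_right_mem : ∀ s t : A ⊗[ℂ] B, t ∈ I → t * s ∈ I
  star_mem : ∀ t : A ⊗[ℂ] B, t ∈ I → star t ∈ I

variable (X A B) in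
/-- `𝓘(A, B)`: the involutive ideal of the algebraic tensor product `A ⊗ B` generated by the
elements `(f a) ⊗ b - a ⊗ (f b)`. -/
def idealI [CXAlgebra X A] [CXAlgebra X B] : Submodule ℂ (A ⊗[ℂ] B) :=
  sInf {I | IsInvolutiveIdeal I ∧
    ∀ (f : C(X, ℂ)) (a : A) (b : B), act f a ⊗ₜ[ℂ] b - a ⊗ₜ[ℂ] act f b ∈ I}

variable (X A B) in
/-- `𝓙(A, B)`: the elements `α` of the algebraic tensor product `A ⊗ B` such that `α_x = 0` in
the algebraic tensor product `A_x ⊗ B_x` for every `x ∈ X`. -/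
def idealJ [CXAlgebra X A] [CXAlgebra X B] : Submodule ℂ (A ⊗[ℂ] B) :=
  ⨅ x : X, LinearMap.ker (TensorProduct.map (toFiber A x) (toFiber B x))

end

end CXAlgebra

/-! Since `C(X)` acts centrally, the balanced elements already span an involutive ideal, and the
content is `idealJ ≤ balancedSpan`. Let `∑ aᵢ ⊗ bᵢ` vanish in every fibre. It suffices to write `aᵢ
= ∑ⱼ fᵢⱼ vⱼ` with `fᵢⱼ ∈ C(X)` such that the matrix at each `x` kills the space `K_x` of linear
relations among the `(aᵢ)_x`. Then each `∑ᵢ fᵢⱼ bᵢ` is zero in all fibres of `B`, hence zero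
(`norm_le_of_forall_toFiber`), and `∑ aᵢ ⊗ bᵢ` is the sum of the elements `fᵢⱼ vⱼ ⊗ bᵢ - vⱼ ⊗ fᵢⱼ
bᵢ`.

Such a writing is a Cohen factorization (`exists_factorization`). Starting from `F₀ = 1`, put `Fₙ₊₁
= Fₙ - 2⁻ⁿ⁻¹ (1 - eₙ)`, where `eₙ` is positive, vanishes on every `K_x` and almost fixes `a Fₙ⁻¹`.
Then `Fₙ` converges to a family killing `K_x`, and `a Fₙ⁻¹` converges to `v`.

The projections onto the complements of `K_x` need not be continuous in `x`, so `eₙ` is built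
differently. The continuous field hypothesis makes the seminorms `w ↦ ‖(∑ wᵢ aᵢ)_x‖` jointly
continuous; proximal points for them give continuous sections of the complements with a prescribed
value at one point, and a partition of unity glues the resulting local solutions
(`exists_approximate_unit`). -/

namespace CXAlgebra

noncomputable section

variable {X A B : Type*} [TopologicalSpace X]
  [NonUnitalCStarAlgebra A] [NonUnitalCStarAlgebra B]

/-! ### The action of `C(X)` on `A` and on its fibres. -/

section Action

variable [CXAlgebra X A]

variable (X A) in
/-- The product `f a` as a bilinear map. -/
def actBilin : C(X, ℂ) →ₗ[ℂ] A →ₗ[ℂ] A :=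
  LinearMap.mk₂ ℂ (fun f a => act f a) (fun f g a => by simp [act, map_add])
    (fun c f a => by simp [act, map_smul]) (fun f a b => by simp [act])
    (fun c f a => by simp [act])

lemma actBilin_apply (f : C(X, ℂ)) (a : A) : actBilin X A f a = act f a := rfl

lemma act_add (f : C(X, ℂ)) (a b : A) : act f (a + b) = act f a + act f b :=
  map_add (actBilin X A f) a b

lemma act_zero (f : C(X, ℂ)) : act f (0 : A) = 0 := map_zero (actBilin X A f)

lemma act_smul (f : C(X, ℂ)) (c : ℂ) (a : A) : act f (c • a) = c • act f a :=
  map_smul (actBilin X A f) c a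

lemma sum_act {ι : Type*} (s : Finset ι) (f : ι → C(X, ℂ)) (a : A) :
    act (∑ i ∈ s, f i) a = ∑ i ∈ s, act (f i) a := by
  simp only [← actBilin_apply, map_sum, LinearMap.sum_apply]

lemma sub_act (f g : C(X, ℂ)) (a : A) : act (f - g) a = act f a - act g a := by
  simp only [← actBilin_apply, map_sub, LinearMap.sub_apply]

lemma const_act (c : ℂ) (a : A) : act (algebraMap ℂ C(X, ℂ) c) a = c • a := by
  rw [Algebra.algebraMap_eq_smul_one, ← actBilin_apply, map_smul, LinearMap.smul_apply,
    actBilin_apply]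
  simp [act]

lemma one_act (a : A) : act (1 : C(X, ℂ)) a = a := by simp [act]

lemma mul_act (f g : C(X, ℂ)) (a : A) : act (f * g) a = act f (act g a) := by
  simp [act]

/-- The double centralizer identity gives equality after left multiplication by any `x`; an element
killed by all of `A` is zero by the C⋆-identity. -/
lemma act_mul_left (f : C(X, ℂ)) (a b : A) : act f (a * b) = act f a * b := by
  have h : ∀ x : A, x * (act f (a * b) - act f a * b) = 0 := fun x => by
    have h₁ := (hom f : 𝓜(ℂ, A)).central x (a * b)
    have h₂ := (hom f : 𝓜(ℂ, A)).central x a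
    simp only [act]
    rw [mul_sub, ← h₁, ← mul_assoc, ← mul_assoc, h₂, sub_self]
  exact sub_eq_zero.1 ((CStarRing.star_mul_self_eq_zero_iff _).1 (h _))

lemma act_mul_right (f : C(X, ℂ)) (a b : A) : act f (a * b) = a * act f b := by
  have h := Subalgebra.mem_center_iff.1 (hom_mem_center (X := X) (A := A) f)
    (DoubleCentralizer.coe ℂ a)
  have h' := congrArg (fun m : 𝓜(ℂ, A) => m.fst b) h
  simpa [act] using h'.symm

/-- Needed for `star_act`, because the involution of the multiplier algebra exchanges the two
components. -/
lemma hom_snd (f : C(X, ℂ)) (a : A) : (hom f : 𝓜(ℂ, A)).snd a = act f a := by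
  have h : ∀ y : A, ((hom f : 𝓜(ℂ, A)).snd a - act f a) * y = 0 := fun y => by
    rw [sub_mul, (hom f : 𝓜(ℂ, A)).central, ← act_mul_left, act_mul_right]
    exact sub_self _
  exact sub_eq_zero.1 ((CStarRing.mul_star_self_eq_zero_iff _).1 (h _))

lemma star_act (f : C(X, ℂ)) (a : A) : star (act f a) = act (star f) (star a) := by
  symm
  rw [act, map_star hom f, DoubleCentralizer.star_fst, star_star, hom_snd]

lemma norm_act_le [CompactSpace X] (f : C(X, ℂ)) (a : A) : ‖act f a‖ ≤ ‖f‖ * ‖a‖ := by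
  refine ((hom f : 𝓜(ℂ, A)).fst.le_opNorm a).trans ?_
  rw [DoubleCentralizer.norm_fst]
  gcongr
  exact NonUnitalStarAlgHom.norm_apply_le (hom (X := X) (A := A)) f

lemma toFiber_act (x : X) (f : C(X, ℂ)) (a : A) :
    toFiber A x (act f a) = f x • toFiber A x a := by
  rw [← map_smul, ← sub_eq_zero, ← map_sub, ← const_act (X := X), ← sub_act,
    Submodule.mkQ_apply, Submodule.Quotient.mk_eq_zero]
  exact Submodule.le_topologicalClosure _ (Submodule.subset_span ⟨_, a, by simp, rfl⟩)

instance isClosed_fiberIdeal (x : X) : IsClosed (fiberIdeal A x : Set A) :=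
  Submodule.isClosed_topologicalClosure _

lemma toFiber_eq_zero_of_norm {x : X} {a : A} (h : ‖toFiber A x a‖ = 0) : toFiber A x a = 0 :=
  norm_eq_zero.1 h

lemma norm_toFiber_le (x : X) (a : A) : ‖toFiber A x a‖ ≤ ‖a‖ :=
  Submodule.Quotient.norm_mk_le _ a

end Action

/-! ### Fibres determine the norm. -/

section Norm

variable [CXAlgebra X A] [CompactSpace X]

/-- For a generator `f a` with `f x = 0`, the product `ψ f` is uniformly small once `ψ` lives where
`f` is small. -/
lemma exists_nhds_norm_act_le_of_mem_span {x : X} {b : A}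
    (hb : b ∈ Submodule.span ℂ {c : A | ∃ (f : C(X, ℂ)) (a : A), f x = 0 ∧ c = act f a})
    {ε : ℝ} (hε : 0 < ε) :
    ∃ U ∈ nhds x, ∀ ψ : C(X, ℂ), ‖ψ‖ ≤ 1 → (∀ y ∉ U, ψ y = 0) → ‖act ψ b‖ ≤ ε := by
  induction hb using Submodule.span_induction generalizing ε with
  | mem c hc =>
    obtain ⟨f, a, hf, rfl⟩ := hc
    have hδ : 0 < ε / (‖a‖ + 1) := by positivity
    refine ⟨{y | ‖f y‖ < ε / (‖a‖ + 1)},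
      (isOpen_lt (by fun_prop) continuous_const).mem_nhds (by simpa [hf] using hδ), ?_⟩
    intro ψ hψ hU
    rw [← mul_act]
    have h : ‖ψ * f‖ ≤ ε / (‖a‖ + 1) := by
      rw [ContinuousMap.norm_le _ hδ.le]
      intro y
      by_cases hy : ‖f y‖ < ε / (‖a‖ + 1)
      · have := (ψ.norm_coe_le_norm y).trans hψ
        simp only [ContinuousMap.mul_apply, norm_mul]
        nlinarith [norm_nonneg (f y), norm_nonneg (ψ y)]
      · simp [hU y hy, hδ.le]
    calc ‖act (ψ * f) a‖ ≤ ε / (‖a‖ + 1) * ‖a‖ :=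
          (norm_act_le _ _).trans (by gcongr)
      _ ≤ ε / (‖a‖ + 1) * (‖a‖ + 1) := by gcongr; linarith
      _ = ε := by field_simp
  | zero => exact ⟨Set.univ, Filter.univ_mem, fun ψ _ _ => by simpa [act_zero] using hε.le⟩
  | add b c _ _ hb hc =>
    obtain ⟨U, hU, h₁⟩ := hb (half_pos hε)
    obtain ⟨V, hV, h₂⟩ := hc (half_pos hε)
    refine ⟨U ∩ V, Filter.inter_mem hU hV, fun ψ hψ h => ?_⟩
    rw [act_add]
    refine (norm_add_le _ _).trans ?_
    linarith [h₁ ψ hψ fun y hy => h y fun h' => hy h'.1, h₂ ψ hψ fun y hy => h y fun h' => hy h'.2]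
  | smul c b _ hb =>
    have hδ : 0 < ε / (‖c‖ + 1) := by positivity
    obtain ⟨U, hU, h₁⟩ := hb hδ
    refine ⟨U, hU, fun ψ hψ h => ?_⟩
    rw [act_smul, norm_smul]
    calc ‖c‖ * ‖act ψ b‖ ≤ (‖c‖ + 1) * (ε / (‖c‖ + 1)) := by
          gcongr
          · linarith
          · exact h₁ ψ hψ h
      _ = ε := by field_simp

lemma exists_open_norm_act_le {x : X} {a : A} {c : ℝ} (h : ‖toFiber A x a‖ < c) :
    ∃ U : Set X, IsOpen U ∧ x ∈ U ∧
      ∀ ψ : C(X, ℂ), ‖ψ‖ ≤ 1 → (∀ y ∉ U, ψ y = 0) → ‖act ψ a‖ ≤ c := by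
  obtain ⟨m, hm, hmc⟩ := Submodule.Quotient.norm_mk_lt (toFiber A x a) (sub_pos.2 h)
  have hmem : a - m ∈ closure ((Submodule.span ℂ
      {c : A | ∃ (f : C(X, ℂ)) (a : A), f x = 0 ∧ c = act f a} : Submodule ℂ A) : Set A) := by
    have : a - m ∈ fiberIdeal A x := (Submodule.Quotient.eq _).1 hm.symm
    exact this
  obtain ⟨b, hb, hab⟩ := Metric.mem_closure_iff.1 hmem (c - ‖m‖) (by linarith)
  rw [dist_eq_norm] at hab
  have hlt : ‖a - b‖ < c := by
    have := norm_add_le (a - m - b) m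
    rw [show a - m - b + m = a - b by abel] at this
    linarith
  obtain ⟨U, hU, hUb⟩ := exists_nhds_norm_act_le_of_mem_span hb (sub_pos.2 hlt)
  obtain ⟨V, hVU, hV, hxV⟩ := mem_nhds_iff.1 hU
  refine ⟨V, hV, hxV, fun ψ hψ h => ?_⟩
  have h₁ := hUb ψ hψ fun y hy => h y fun h' => hy (hVU h')
  have h₂ : ‖act ψ (a - b)‖ ≤ ‖a - b‖ :=
    (norm_act_le _ _).trans (mul_le_of_le_one_left (norm_nonneg _) hψ)
  have h₃ := norm_add_le (act ψ (a - b)) (act ψ b)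
  rw [← act_add, sub_add_cancel] at h₃
  linarith

end Norm

section FiberNorm

variable [CXAlgebra X A]

/-- A real continuous function, seen as a complex one. -/
def complexify (ψ : C(X, ℝ)) : C(X, ℂ) := ⟨fun x => (ψ x : ℂ), by fun_prop⟩

lemma complexify_apply (ψ : C(X, ℝ)) (x : X) : complexify ψ x = (ψ x : ℂ) := rfl

/-- The norm of `a` on `U` is at most `c`, tested by multiplication with bump functions. -/
def NormLEOn (U : Set X) (a : A) (c : ℝ) : Prop :=
  ∀ ψ : C(X, ℝ), (∀ y, ψ y ∈ Set.Icc (0 : ℝ) 1) → (∀ y ∉ U, ψ y = 0) → ‖act (complexify ψ) a‖ ≤ c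

/-- With `θ = √ψ` one has `ψ (a⋆ a) = (θ a)⋆ (θ a)`, and the C⋆-identity applies. -/
lemma NormLEOn.star_mul_self {U : Set X} {a : A} {c : ℝ} (h : NormLEOn U a c) :
    NormLEOn U (star a * a) (c ^ 2) := by
  intro ψ hψ hU
  let θ : C(X, ℝ) := ⟨fun x => Real.sqrt (ψ x), by fun_prop⟩
  have hθ : complexify ψ = star (complexify θ) * complexify θ := by
    ext x
    simp only [ContinuousMap.mul_apply, ContinuousMap.star_apply, complexify_apply,
      RCLike.star_def, Complex.conj_ofReal, ← Complex.ofReal_mul]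
    exact congrArg _ (Real.mul_self_sqrt (hψ x).1).symm
  have hle := h θ (fun y => ⟨Real.sqrt_nonneg _, Real.sqrt_le_one.2 (hψ y).2⟩)
    (fun y hy => by simp [θ, hU y hy])
  rw [hθ, mul_act, act_mul_right, act_mul_left, ← star_act, CStarRing.norm_star_mul_self, ← sq]
  gcongr

/-- The triangle inequality over the partition of unity costs a factor `n`. Replacing `a` by `a⋆ a`
squares both norms but not `n`, which therefore becomes harmless for large `k`. -/
lemma norm_pow_le_of_normLEOn {n : ℕ} {U : Fin n → Set X} {φ : Fin n → C(X, ℝ)}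
    (hφ : ∀ i y, φ i y ∈ Set.Icc (0 : ℝ) 1) (hU : ∀ i, ∀ y ∉ U i, φ i y = 0)
    (hsum : ∑ i, φ i = 1) (k : ℕ) {a : A} {c : ℝ} (h : ∀ i, NormLEOn (U i) a c) :
    ‖a‖ ^ 2 ^ k ≤ n * c ^ 2 ^ k := by
  induction k generalizing a c with
  | zero =>
    have h1 : ∑ i, complexify (φ i) = 1 := by
      ext x
      have := congrArg (fun f : C(X, ℝ) => ((f x : ℝ) : ℂ)) hsum
      simpa [complexify_apply, ContinuousMap.sum_apply] using this
    calc ‖a‖ ^ 2 ^ 0 = ‖∑ i, act (complexify (φ i)) a‖ := by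
          rw [← sum_act, h1, one_act, pow_zero, pow_one]
      _ ≤ ∑ _i : Fin n, c := norm_sum_le_of_le _ fun i _ => h i (φ i) (hφ i) (hU i)
      _ = n * c ^ 2 ^ 0 := by simp
  | succ k ih =>
    have := ih fun i => (h i).star_mul_self
    rwa [CStarRing.norm_star_mul_self, ← sq, ← pow_mul, ← pow_mul, ← pow_succ'] at this

lemma norm_le_of_forall_lt [CompactSpace X] [T2Space X] {a : A} {c : ℝ} (hc : 0 < c)
    (h : ∀ x : X, ‖toFiber A x a‖ < c) : ‖a‖ ≤ c := by
  choose U hUo hxU hU using fun x => exists_open_norm_act_le (h x)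
  obtain ⟨t, ht⟩ := isCompact_univ.elim_finite_subcover U hUo
    (fun x _ => Set.mem_iUnion.2 ⟨x, hxU x⟩)
  let e := t.equivFin.symm
  obtain ⟨φ, hφU, hφ1, hφ, -⟩ := exists_continuous_sum_one_of_isOpen_isCompact
    (s := fun i => U (e i)) (fun i => hUo _) isCompact_univ (fun x hx => by
      obtain ⟨y, hy, hxy⟩ := Set.mem_iUnion₂.1 (ht hx)
      exact Set.mem_iUnion.2 ⟨t.equivFin ⟨y, hy⟩, by simpa [e] using hxy⟩)
  have key (k : ℕ) : ‖a‖ ^ 2 ^ k ≤ t.card * c ^ 2 ^ k := by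
    refine norm_pow_le_of_normLEOn (U := fun i => U (e i)) hφ (fun i y hy => ?_) ?_ k ?_
    · exact image_eq_zero_of_notMem_tsupport fun h' => hy (hφU i h')
    · ext x
      simpa [ContinuousMap.sum_apply] using hφ1 (Set.mem_univ x)
    · intro i ψ hψ hψU
      refine hU (e i) _ ?_ fun y hy => by simp [complexify_apply, hψU y hy]
      rw [ContinuousMap.norm_le _ zero_le_one]
      intro y
      simpa [complexify_apply, abs_of_nonneg (hψ y).1] using (hψ y).2
  by_contra! hlt
  have h1 : 1 < ‖a‖ / c := (one_lt_div hc).2 hlt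
  obtain ⟨k, hk⟩ := pow_unbounded_of_one_lt (t.card : ℝ) h1
  have h2 : (‖a‖ / c) ^ k ≤ (‖a‖ / c) ^ 2 ^ k :=
    pow_le_pow_right₀ h1.le Nat.lt_two_pow_self.le
  have h3 : (‖a‖ / c) ^ 2 ^ k ≤ t.card := by
    rw [div_pow, div_le_iff₀ (by positivity)]
    exact key k
  linarith

theorem norm_le_of_forall_toFiber [CompactSpace X] [T2Space X] {a : A} {c : ℝ} (hc : 0 ≤ c)
    (h : ∀ x : X, ‖toFiber A x a‖ ≤ c) : ‖a‖ ≤ c :=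
  le_of_forall_gt_imp_ge_of_dense fun _ hd =>
    norm_le_of_forall_lt (hc.trans_lt hd) fun x => (h x).trans_lt hd

theorem eq_zero_of_forall_toFiber [CompactSpace X] [T2Space X] {a : A} (h : ∀ x : X, toFiber A x a = 0) : a = 0 :=
  norm_le_zero_iff.1 (norm_le_of_forall_toFiber le_rfl fun x => by rw [h x, norm_zero])

theorem ext_toFiber [CompactSpace X] [T2Space X] {a b : A} (h : ∀ x : X, toFiber A x a = toFiber A x b) : a = b :=
  sub_eq_zero.1 (eq_zero_of_forall_toFiber (X := X) fun x => by rw [map_sub, h x, sub_self])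

end FiberNorm

/-! ### The ideal generated by the balanced elements. -/

section Ideal

variable [CXAlgebra X A] [CXAlgebra X B]

variable (X A B) in
/-- The linear span of the elements `(f a) ⊗ b - a ⊗ (f b)`. -/
def balancedSpan : Submodule ℂ (A ⊗[ℂ] B) :=
  Submodule.span ℂ {t | ∃ (f : C(X, ℂ)) (a : A) (b : B),
    t = act f a ⊗ₜ[ℂ] b - a ⊗ₜ[ℂ] act f b}

lemma act_tmul_sub_mem (f : C(X, ℂ)) (a : A) (b : B) :
    act f a ⊗ₜ[ℂ] b - a ⊗ₜ[ℂ] act f b ∈ balancedSpan X A B :=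
  Submodule.subset_span ⟨f, a, b, rfl⟩

lemma isInvolutiveIdeal_balancedSpan : IsInvolutiveIdeal (balancedSpan X A B) where
  mul_left_mem s t ht := by
    induction ht using Submodule.span_induction with
    | mem t ht =>
      obtain ⟨f, a, b, rfl⟩ := ht
      induction s using TensorProduct.induction_on with
      | zero => simp
      | tmul c d =>
        rw [mul_sub, Algebra.TensorProduct.tmul_mul_tmul, Algebra.TensorProduct.tmul_mul_tmul,
          ← act_mul_right, ← act_mul_right]
        exact act_tmul_sub_mem f _ _
      | add s s' h h' => rw [add_mul]; exact add_mem h h'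
    | zero => simp
    | add t t' _ _ h h' => rw [mul_add]; exact add_mem h h'
    | smul c t _ h => rw [mul_smul_comm]; exact Submodule.smul_mem _ _ h
  mul_right_mem s t ht := by
    induction ht using Submodule.span_induction with
    | mem t ht =>
      obtain ⟨f, a, b, rfl⟩ := ht
      induction s using TensorProduct.induction_on with
      | zero => simp
      | tmul c d =>
        rw [sub_mul, Algebra.TensorProduct.tmul_mul_tmul, Algebra.TensorProduct.tmul_mul_tmul,
          ← act_mul_left, ← act_mul_left]
        exact act_tmul_sub_mem f _ _
      | add s s' h h' => rw [mul_add]; exact add_mem h h'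
    | zero => simp
    | add t t' _ _ h h' => rw [add_mul]; exact add_mem h h'
    | smul c t _ h => rw [smul_mul_assoc]; exact Submodule.smul_mem _ _ h
  star_mem t ht := by
    induction ht using Submodule.span_induction with
    | mem t ht =>
      obtain ⟨f, a, b, rfl⟩ := ht
      rw [star_sub, TensorProduct.star_tmul, TensorProduct.star_tmul, star_act, star_act]
      exact act_tmul_sub_mem _ _ _
    | zero => simp
    | add t t' _ _ h h' => rw [star_add]; exact add_mem h h'
    | smul c t _ h => rw [star_smul]; exact Submodule.smul_mem _ _ h

lemma idealI_eq_balancedSpan : idealI X A B = balancedSpan X A B := by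
  refine le_antisymm (sInf_le ⟨isInvolutiveIdeal_balancedSpan, act_tmul_sub_mem⟩) ?_
  refine le_sInf fun I hI => Submodule.span_le.2 ?_
  rintro _ ⟨f, a, b, rfl⟩
  exact hI.2 f a b

lemma balancedSpan_le_idealJ : balancedSpan X A B ≤ idealJ X A B := by
  refine le_iInf fun x => Submodule.span_le.2 ?_
  rintro _ ⟨f, a, b, rfl⟩
  rw [SetLike.mem_coe, LinearMap.mem_ker, map_sub, TensorProduct.map_tmul, TensorProduct.map_tmul,
    toFiber_act, toFiber_act, TensorProduct.smul_tmul, sub_self]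

end Ideal

end

end CXAlgebra

/-! ### Proximal points of seminorms. -/

section MoreauEnvelope

variable {X E : Type*} [TopologicalSpace X] [NormedAddCommGroup E] [InnerProductSpace ℂ E]

lemma inner_eq_zero_of_forall_norm_le {k s : E} (h : ∀ c : ℂ, ‖s‖ ≤ ‖s - c • k‖) :
    inner ℂ k s = 0 := by
  set z := inner ℂ k s with hz
  -- The test vector uses `c = r z`; this `r` avoids dividing by `‖k‖`, and `r ‖k‖² ≤ 1` is all that
  -- is needed.
  set r : ℝ := 1 / (‖k‖ ^ 2 + 1) with hr
  have hr0 : 0 < r := by positivity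
  have h1 := pow_le_pow_left₀ (norm_nonneg _) (h ((r : ℂ) * z)) 2
  rw [norm_sub_sq (𝕜 := ℂ), inner_smul_right, ← inner_conj_symm, ← hz, mul_assoc,
    Complex.mul_conj, norm_smul, norm_mul, Complex.norm_real, Real.norm_of_nonneg hr0.le,
    ← Complex.ofReal_mul, RCLike.re_to_complex, Complex.ofReal_re, Complex.normSq_eq_norm_sq] at h1
  have h2 : r * ‖k‖ ^ 2 ≤ 1 := by
    rw [hr, one_div_mul_eq_div, div_le_one (by positivity)]
    linarith
  have h3 : ‖z‖ ^ 2 ≤ 0 := by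
    have : r * ‖z‖ ^ 2 * (2 - r * ‖k‖ ^ 2) ≤ 0 := by nlinarith
    by_contra! hpos
    have : 0 < r * ‖z‖ ^ 2 * (2 - r * ‖k‖ ^ 2) := by
      have : 0 < 2 - r * ‖k‖ ^ 2 := by linarith
      positivity
    linarith
  have h4 : ‖z‖ = 0 := by nlinarith [norm_nonneg z]
  exact norm_eq_zero.1 h4

lemma Seminorm.map_add_eq_of_eq_zero (p : Seminorm ℂ E) {k : E} (hk : p k = 0) (w : E) :
    p (w + k) = p w := by
  have h1 := map_add_le_add p w k
  have h2 := map_sub_le_add p (w + k) k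
  rw [add_sub_cancel_right] at h2
  linarith

/-- The vectors of seminorm zero. -/
def Seminorm.nullSubmodule (p : Seminorm ℂ E) : Submodule ℂ E where
  carrier := {k | p k = 0}
  add_mem' {a b} ha hb := (p.map_add_eq_of_eq_zero hb a).trans ha
  zero_mem' := map_zero _
  smul_mem' c a ha := by
    change p (c • a) = 0
    rw [map_smul_eq_mul, show p a = 0 from ha, mul_zero]

/-- The function whose minimizer in `μ` is the proximal point of `v` for the seminorm `R p`. -/
noncomputable def proxFun (p : Seminorm ℂ E) (R : ℝ) (v μ : E) : ℝ := R * p μ + ‖v - μ‖ ^ 2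

lemma proxFun_zero (p : Seminorm ℂ E) (R : ℝ) (v : E) : proxFun p R v 0 = ‖v‖ ^ 2 := by
  simp [proxFun]

lemma exists_forall_proxFun_le [FiniteDimensional ℂ E] {p : Seminorm ℂ E} (hp : Continuous p)
    {R : ℝ} (hR : 0 ≤ R) (v : E) : ∃ μ, ∀ ν, proxFun p R v μ ≤ proxFun p R v ν := by
  have : ProperSpace E := FiniteDimensional.proper ℂ E
  have hcont : Continuous (proxFun p R v) := by unfold proxFun; fun_prop
  obtain ⟨μ, hμ, hmin⟩ := (isCompact_closedBall (0 : E) (2 * ‖v‖)).exists_isMinOn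
    ⟨0, Metric.mem_closedBall_self (by positivity)⟩ hcont.continuousOn
  refine ⟨μ, fun ν => ?_⟩
  by_cases hν : ν ∈ Metric.closedBall (0 : E) (2 * ‖v‖)
  · exact hmin hν
  · refine (hmin (Metric.mem_closedBall_self (by positivity))).trans ?_
    rw [proxFun_zero]
    rw [mem_closedBall_zero_iff, not_le] at hν
    have h1 : ‖v‖ ≤ ‖v - ν‖ := by
      have := norm_sub_norm_le ν v
      rw [norm_sub_rev] at this
      linarith
    have h2 := pow_le_pow_left₀ (norm_nonneg _) h1 2
    have h3 : 0 ≤ R * p ν := mul_nonneg hR (apply_nonneg p ν)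
    unfold proxFun
    linarith

section Minimizer

variable {p : Seminorm ℂ E} {R : ℝ} {v μ : E}

lemma norm_sub_le_of_isMin (hR : 0 ≤ R) (h : ∀ ν, proxFun p R v μ ≤ proxFun p R v ν) :
    ‖v - μ‖ ≤ ‖v‖ := by
  have h0 := h 0
  rw [proxFun_zero] at h0
  have h3 : 0 ≤ R * p μ := mul_nonneg hR (apply_nonneg p μ)
  unfold proxFun at h0
  exact le_of_sq_le_sq (by linarith) (norm_nonneg _)

/-- Moving `μ` along `k` leaves the penalty `p` unchanged, so `μ` minimizes the distance to `v` in
that direction. -/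
lemma inner_eq_zero_of_isMin (h : ∀ ν, proxFun p R v μ ≤ proxFun p R v ν) {k : E}
    (hk : p k = 0) : inner ℂ k (v - μ) = 0 := by
  refine inner_eq_zero_of_forall_norm_le fun c => ?_
  have hck : p (c • k) = 0 := by rw [map_smul_eq_mul, hk, mul_zero]
  have h1 := h (μ + c • k)
  unfold proxFun at h1
  rw [p.map_add_eq_of_eq_zero hck, ← sub_sub] at h1
  exact le_of_sq_le_sq (by linarith) (norm_nonneg _)

/-- Strong convexity: test minimality at the midpoint of `μ` and `ν`. This yields continuity of the
minimizer in the seminorm. -/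
lemma sq_norm_sub_le_of_isMin (hR : 0 ≤ R) (h : ∀ ν, proxFun p R v μ ≤ proxFun p R v ν) (ν : E) :
    ‖ν - μ‖ ^ 2 ≤ 2 * (proxFun p R v ν - proxFun p R v μ) := by
  have h1 := h ((1 / 2 : ℂ) • (μ + ν))
  have h2 : p ((1 / 2 : ℂ) • (μ + ν)) ≤ (p μ + p ν) / 2 := by
    rw [map_smul_eq_mul]
    have := map_add_le_add p μ ν
    norm_num
    linarith
  have h3 := parallelogram_law_with_norm ℂ (v - μ) (v - ν)
  have h4 : v - μ + (v - ν) = (2 : ℂ) • (v - (1 / 2 : ℂ) • (μ + ν)) := by module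
  rw [h4, sub_sub_sub_cancel_left, norm_smul] at h3
  have h5 := mul_le_mul_of_nonneg_left h2 hR
  unfold proxFun at h1 ⊢
  rw [mul_pow, Complex.norm_ofNat] at h3
  linarith

/-- Exact penalty: dropping the component `w` of `μ` orthogonal to `K` saves at least `R δ ‖w‖` and
costs at most `2 ‖v‖ ‖w‖`. -/
lemma map_eq_zero_of_isMin [FiniteDimensional ℂ E] {δ : ℝ} {K : Submodule ℂ E}
    (hK : ∀ k, k ∈ K ↔ p k = 0) (hδ : ∀ w ∈ Kᗮ, δ * ‖w‖ ≤ p w) (hR : 0 ≤ R)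
    (hRδ : 2 * ‖v‖ < R * δ) (h : ∀ ν, proxFun p R v μ ≤ proxFun p R v ν) : p μ = 0 := by
  obtain ⟨k, hk, w, hw, rfl⟩ := K.exists_add_mem_mem_orthogonal μ
  have hkp := (hK k).1 hk
  have hw0 : w = 0 := by
    by_contra hne
    have hwpos : 0 < ‖w‖ := norm_pos_iff.2 hne
    have h1 := h k
    unfold proxFun at h1
    rw [add_comm k w, p.map_add_eq_of_eq_zero hkp, hkp, add_comm w k, ← sub_sub,
      norm_sub_sq (𝕜 := ℂ) (v - k) w, inner_sub_left, hw k hk, sub_zero] at h1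
    have h2 : RCLike.re (inner ℂ v w) ≤ ‖v‖ * ‖w‖ := re_inner_le_norm v w
    have h3 := mul_le_mul_of_nonneg_left (hδ w hw) hR
    nlinarith
  rwa [hw0, add_zero]

end Minimizer

/-- For a jointly continuous family of seminorms, a vector `v` and a point `y`, there is a
continuous section of the orthogonal complements of the kernels, whose value at `y` is the
projection of `v`. -/
theorem exists_continuous_orthogonal_section [FiniteDimensional ℂ E] {N : X → Seminorm ℂ E}
    (hN : Continuous fun q : X × E => N q.1 q.2) (v : E) (y : X) :
    ∃ s : C(X, E), (∀ x k, N x k = 0 → inner ℂ k (s x) = 0) ∧ (∀ x, ‖s x‖ ≤ ‖v‖) ∧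
      N y (v - s y) = 0 := by
  have : ProperSpace E := FiniteDimensional.proper ℂ E
  have hNx (x : X) : Continuous (N x) := hN.comp (by fun_prop : Continuous fun w : E => (x, w))
  let K : Submodule ℂ E := (N y).nullSubmodule
  obtain ⟨δ, hδ0, hδ⟩ : ∃ δ : ℝ, 0 < δ ∧ ∀ w ∈ Kᗮ, δ * ‖w‖ ≤ N y w := by
    have hcomp : IsCompact (Metric.sphere (0 : E) 1 ∩ (Kᗮ : Set E)) :=
      (isCompact_sphere _ _).inter_right (Submodule.isClosed_orthogonal K)
    obtain ⟨δ, hδ0, hδ⟩ : ∃ δ : ℝ, 0 < δ ∧ ∀ w ∈ Metric.sphere (0 : E) 1 ∩ (Kᗮ : Set E),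
        δ ≤ N y w := by
      refine hcomp.exists_forall_le' (hNx y).continuousOn fun w hw => ?_
      refine lt_of_le_of_ne (apply_nonneg _ _) fun h0 => ?_
      have hwK : w ∈ K := h0.symm
      have hw0 : w = 0 := inner_self_eq_zero.1 (hw.2 w hwK)
      simpa [hw0] using hw.1
    refine ⟨δ, hδ0, fun w hw => ?_⟩
    rcases eq_or_ne w 0 with rfl | hne
    · simp
    · have hpos : 0 < ‖w‖ := norm_pos_iff.2 hne
      have := hδ (((‖w‖⁻¹ : ℝ) : ℂ) • w) ⟨by simp [norm_smul, hpos.ne'], Kᗮ.smul_mem _ hw⟩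
      rw [map_smul_eq_mul, Complex.norm_real, Real.norm_of_nonneg (by positivity),
        inv_mul_eq_div, le_div_iff₀ hpos] at this
      exact this
  -- Large enough for the penalty to be exact at `y`; at other points only orthogonality to the
  -- kernel is claimed.
  set R : ℝ := (2 * ‖v‖ + 1) / δ with hRdef
  have hR : 0 ≤ R := by positivity
  choose μ hμ using fun x => exists_forall_proxFun_le (hNx x) hR v
  have hμball (x : X) : μ x ∈ Metric.closedBall (0 : E) (2 * ‖v‖) := by
    have h1 := norm_sub_le_of_isMin hR (hμ x)
    have h2 := norm_sub_norm_le (μ x) v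
    rw [norm_sub_rev] at h2
    rw [mem_closedBall_zero_iff]
    linarith
  have hcont : Continuous μ := by
    refine continuous_iff_continuousAt.2 fun x₀ => Metric.tendsto_nhds.2 fun ε hε => ?_
    have hη : 0 < ε ^ 2 / (4 * (R + 1)) := by positivity
    -- The seminorms at nearby points are uniformly close on a ball containing all the minimizers.
    obtain ⟨V, hV, hVN⟩ := (isCompact_closedBall (0 : E) (2 * ‖v‖)).mem_uniformity_of_prod
      (f := fun x w => N x w) (s := Set.univ) hN.continuousOn (Set.mem_univ x₀)
      (Metric.dist_mem_uniformity hη)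
    rw [nhdsWithin_univ] at hV
    filter_upwards [hV] with x hx
    have h1 := sq_norm_sub_le_of_isMin hR (hμ x₀) (μ x)
    have h2 := hμ x (μ x₀)
    have h3 : dist (N x (μ x)) (N x₀ (μ x)) < ε ^ 2 / (4 * (R + 1)) := hVN x hx _ (hμball x)
    have h4 : dist (N x (μ x₀)) (N x₀ (μ x₀)) < ε ^ 2 / (4 * (R + 1)) := hVN x hx _ (hμball x₀)
    rw [Real.dist_eq, abs_lt] at h3 h4
    unfold proxFun at h1 h2
    have h5 : R * (ε ^ 2 / (4 * (R + 1))) < ε ^ 2 / 4 := by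
      rw [mul_div_assoc', div_lt_div_iff₀ (by positivity) (by positivity)]
      nlinarith [sq_pos_of_pos hε]
    have h6 := mul_le_mul_of_nonneg_left h3.1.le hR
    have h7 := mul_le_mul_of_nonneg_left h4.2.le hR
    rw [dist_eq_norm]
    refine lt_of_pow_lt_pow_left₀ 2 hε.le ?_
    nlinarith
  refine ⟨⟨fun x => v - μ x, by fun_prop⟩, fun x k hk => inner_eq_zero_of_isMin (hμ x) hk,
    fun x => norm_sub_le_of_isMin hR (hμ x), ?_⟩
  have h0 : N y (μ y) = 0 := by
    refine map_eq_zero_of_isMin (K := K) (fun k => Iff.rfl) hδ hR ?_ (hμ y)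
    rw [hRdef, div_mul_cancel₀ _ hδ0.ne']
    linarith
  simpa using h0

end MoreauEnvelope

/-! ### Continuous extension of a projection from one point. -/

section Projection

variable {X E ι : Type*} [TopologicalSpace X] [NormedAddCommGroup E] [InnerProductSpace ℂ E]
  [Fintype ι]

/-- For a jointly continuous family of seminorms, the orthogonal projection onto the complement
of the kernel at `y` extends to a continuous family of positive operators that vanish on the
kernels. -/
theorem exists_continuous_projection (b : OrthonormalBasis ι ℂ E) {N : X → Seminorm ℂ E}
    (hN : Continuous fun q : X × E => N q.1 q.2) (y : X) :
    ∃ e : C(X, E →L[ℂ] E), (∀ x w, 0 ≤ (inner ℂ w (e x w)).re) ∧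
      (∀ x, ‖e x‖ ≤ Fintype.card ι) ∧ (∀ x k, N x k = 0 → e x k = 0) ∧
      ∀ w, N y (w - e y w) = 0 := by
  have : FiniteDimensional ℂ E := b.toBasis.finiteDimensional_of_finite
  choose s hs0 hs1 hsy using fun i => exists_continuous_orthogonal_section hN (b i) y
  let e : C(X, E →L[ℂ] E) := ⟨fun x => ∑ i, InnerProductSpace.rankOne ℂ (s i x) (s i x), by
    refine continuous_finsetSum _ fun i _ => continuous_clm_apply.2 fun w => ?_
    simp only [InnerProductSpace.rankOne_apply]
    fun_prop⟩
  have he (x : X) (w : E) : e x w = ∑ i, inner ℂ (s i x) w • s i x := by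
    simp [e]
  have hker (x : X) (k : E) (hk : N x k = 0) : e x k = 0 := by
    rw [he]
    refine Finset.sum_eq_zero fun i _ => ?_
    rw [← inner_conj_symm, hs0 i x k hk, map_zero, zero_smul]
  refine ⟨e, fun x w => ?_, fun x => ?_, hker, fun w => ?_⟩
  · rw [he, inner_sum, Complex.re_sum]
    refine Finset.sum_nonneg fun i _ => ?_
    rw [inner_smul_right, ← inner_conj_symm w, Complex.mul_conj, Complex.ofReal_re]
    exact Complex.normSq_nonneg _
  · refine (norm_sum_le_of_le (n := fun _ => 1) _ fun i _ => ?_).trans (by simp)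
    rw [InnerProductSpace.norm_rankOne]
    have := hs1 i x
    rw [b.norm_eq_one] at this
    exact mul_le_one₀ this (norm_nonneg _) this
  · obtain ⟨k, hk, u, hu, rfl⟩ := (N y).nullSubmodule.exists_add_mem_mem_orthogonal w
    -- At `y` each `s i` agrees with `b i` modulo the kernel, so both have the same inner product
    -- with `u`.
    have h1 : u - e y u = ∑ i, inner ℂ (b i) u • (b i - s i y) := by
      simp only [smul_sub, Finset.sum_sub_distrib, b.sum_repr' u, he]
      congr 1
      refine Finset.sum_congr rfl fun i _ => ?_
      congr 1
      have := hu (b i - s i y) (hsy i)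
      rw [inner_sub_left, sub_eq_zero] at this
      exact this.symm
    have h2 : k + u - e y (k + u) = k + (u - e y u) := by
      rw [map_add, hker y k hk]; abel
    rw [h2]
    refine (N y).nullSubmodule.add_mem hk ?_
    rw [h1]
    exact sum_mem fun i _ => Submodule.smul_mem _ _ (hsy i)

end Projection

/-! ### Inverting coercive operators. -/

section Coercive

variable {E : Type*} [NormedAddCommGroup E] [InnerProductSpace ℂ E]

lemma mul_norm_le_of_coercive {F : E →L[ℂ] E} {c : ℝ}
    (h : ∀ w, c * ‖w‖ ^ 2 ≤ (inner ℂ w (F w)).re) (w : E) : c * ‖w‖ ≤ ‖F w‖ := by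
  rcases eq_or_ne w 0 with rfl | hw
  · simp
  · have hpos : 0 < ‖w‖ := norm_pos_iff.2 hw
    have h1 : (inner ℂ w (F w)).re ≤ ‖w‖ * ‖F w‖ := re_inner_le_norm (𝕜 := ℂ) w (F w)
    have h2 := h w
    nlinarith

lemma isUnit_of_coercive [FiniteDimensional ℂ E] {F : E →L[ℂ] E} {c : ℝ} (hc : 0 < c)
    (h : ∀ w, c * ‖w‖ ^ 2 ≤ (inner ℂ w (F w)).re) : IsUnit F := by
  have : CompleteSpace E := FiniteDimensional.complete ℂ E
  have hinj : Function.Injective F := (injective_iff_map_eq_zero F).2 fun w hw => by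
    have h1 := mul_norm_le_of_coercive h w
    rw [hw, norm_zero] at h1
    exact norm_le_zero_iff.1 (by nlinarith)
  exact ContinuousLinearMap.isUnit_iff_bijective.2
    ⟨hinj, (LinearMap.injective_iff_surjective (f := (F : E →ₗ[ℂ] E))).1 hinj⟩

end Coercive

namespace CXAlgebra

noncomputable section

variable {X A B : Type*} [TopologicalSpace X]
  [NonUnitalCStarAlgebra A] [NonUnitalCStarAlgebra B]

/-! ### Finite families in a continuous field, and their approximate units. -/

section Family

variable {ι : Type*} [Fintype ι]

/-- The linear combinations of a finite family in `A`. -/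
def comb (a : ι → A) : EuclideanSpace ℂ ι →ₗ[ℂ] A :=
  Fintype.linearCombination ℂ a ∘ₗ (WithLp.linearEquiv 2 ℂ (ι → ℂ)).toLinearMap

lemma comb_apply (a : ι → A) (w : EuclideanSpace ℂ ι) : comb a w = ∑ i, w i • a i := rfl

lemma comb_single [DecidableEq ι] (a : ι → A) (i : ι) :
    comb a (EuclideanSpace.single i 1) = a i := by
  simp [comb_apply]

lemma comb_sub (a b : ι → A) (w : EuclideanSpace ℂ ι) :
    comb (a - b) w = comb a w - comb b w := by
  simp [comb_apply, smul_sub]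

variable [CXAlgebra X A]

variable (X) in
/-- The seminorm `w ↦ ‖(∑ wᵢ aᵢ)_x‖`. -/
def fiberSeminorm (a : ι → A) (x : X) : Seminorm ℂ (EuclideanSpace ℂ ι) :=
  (normSeminorm ℂ (Fiber A x)).comp (toFiber A x ∘ₗ comb a)

lemma fiberSeminorm_apply (a : ι → A) (x : X) (w : EuclideanSpace ℂ ι) :
    fiberSeminorm X a x w = ‖toFiber A x (comb a w)‖ := rfl

lemma toFiber_comb_eq_zero {a : ι → A} {x : X} {w : EuclideanSpace ℂ ι}
    (h : fiberSeminorm X a x w = 0) : toFiber A x (comb a w) = 0 :=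
  toFiber_eq_zero_of_norm h

lemma continuous_fiberSeminorm (hA : IsContinuousField X A) (a : ι → A) :
    Continuous fun q : X × EuclideanSpace ℂ ι => fiberSeminorm X a q.1 q.2 := by
  have hc : Continuous (comb a) := (comb a).continuous_of_finiteDimensional
  refine continuous_iff_continuousAt.2 fun ⟨x₀, w₀⟩ => ?_
  have h1 : Filter.Tendsto (fun q : X × EuclideanSpace ℂ ι => ‖toFiber A q.1 (comb a w₀)‖)
      (nhds (x₀, w₀)) (nhds ‖toFiber A x₀ (comb a w₀)‖) :=
    ((hA (comb a w₀)).comp continuous_fst).tendsto (x₀, w₀)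
  have h2 : Filter.Tendsto (fun q : X × EuclideanSpace ℂ ι => ‖comb a q.2 - comb a w₀‖)
      (nhds (x₀, w₀)) (nhds 0) := by
    have : Continuous fun q : X × EuclideanSpace ℂ ι => ‖comb a q.2 - comb a w₀‖ := by fun_prop
    simpa using this.tendsto (x₀, w₀)
  have h3 : Filter.Tendsto (fun q : X × EuclideanSpace ℂ ι =>
      fiberSeminorm X a q.1 q.2 - ‖toFiber A q.1 (comb a w₀)‖) (nhds (x₀, w₀)) (nhds 0) := by
    refine squeeze_zero_norm (fun q => ?_) h2
    rw [fiberSeminorm_apply, Real.norm_eq_abs]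
    refine (abs_norm_sub_norm_le _ _).trans ?_
    rw [← map_sub]
    exact norm_toFiber_le _ _
  have h4 := h3.add h1
  simpa [ContinuousAt, fiberSeminorm_apply] using h4

variable [DecidableEq ι]

/-- The matrix entries of a continuous family of operators. -/
def entry (F : C(X, EuclideanSpace ℂ ι →L[ℂ] EuclideanSpace ℂ ι)) (i j : ι) : C(X, ℂ) :=
  ⟨fun x => F x (EuclideanSpace.single i 1) j, by fun_prop⟩

lemma entry_apply (F : C(X, EuclideanSpace ℂ ι →L[ℂ] EuclideanSpace ℂ ι)) (i j : ι) (x : X) :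
    entry F i j x = F x (EuclideanSpace.single i 1) j := rfl

/-- The family `∑ⱼ Fⱼᵢ aⱼ`, for a continuous family `F` of operators. -/
def transform (a : ι → A) (F : C(X, EuclideanSpace ℂ ι →L[ℂ] EuclideanSpace ℂ ι)) : ι → A :=
  fun i => ∑ j, act (entry F i j) (a j)

/-- `transform` is, fibrewise, precomposition with `F`; identities between transforms thus reduce to
identities between operators. -/
lemma toFiber_comb_transform (a : ι → A)
    (F : C(X, EuclideanSpace ℂ ι →L[ℂ] EuclideanSpace ℂ ι)) (x : X) (w : EuclideanSpace ℂ ι) :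
    toFiber A x (comb (transform a F) w) = toFiber A x (comb a (F x w)) := by
  have h : toFiber A x ∘ₗ comb (transform a F) =
      toFiber A x ∘ₗ comb a ∘ₗ (F x : EuclideanSpace ℂ ι →ₗ[ℂ] EuclideanSpace ℂ ι) := by
    refine (EuclideanSpace.basisFun ι ℂ).toBasis.ext fun i => ?_
    rw [OrthonormalBasis.coe_toBasis, EuclideanSpace.basisFun_apply, LinearMap.comp_apply,
      comb_single]
    simp only [LinearMap.comp_apply, transform, map_sum, toFiber_act, comb_apply, map_smul,
      entry_apply]
    rfl
  exact LinearMap.congr_fun h w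

lemma norm_le_of_toFiber_comb [CompactSpace X] [T2Space X] {a : ι → A} {ε : ℝ} (hε : 0 ≤ ε)
    (h : ∀ (x : X) w, ‖toFiber A x (comb a w)‖ ≤ ε * ‖w‖) : ‖a‖ ≤ ε := by
  refine (pi_norm_le_iff_of_nonneg hε).2 fun i => norm_le_of_forall_toFiber (X := X) hε fun x => ?_
  simpa [comb_single] using h x (EuclideanSpace.single i 1)

lemma ext_toFiber_comb [CompactSpace X] [T2Space X] {a b : ι → A}
    (h : ∀ (x : X) w, toFiber A x (comb a w) = toFiber A x (comb b w)) : a = b := by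
  funext i
  refine ext_toFiber (X := X) fun x => ?_
  simpa only [comb_single] using h x (EuclideanSpace.single i 1)

/-- Continuous families of positive operators that vanish where `a` does and almost fix a
family `v` vanishing where `a` does. -/
theorem exists_approximate_unit [CompactSpace X] [T2Space X] (hA : IsContinuousField X A)
    {a v : ι → A} (hv : ∀ x w, fiberSeminorm X a x w = 0 → toFiber A x (comb v w) = 0)
    {ε : ℝ} (hε : 0 < ε) :
    ∃ e : C(X, EuclideanSpace ℂ ι →L[ℂ] EuclideanSpace ℂ ι),
      ∀ x, (∀ w, 0 ≤ (inner ℂ w (e x w)).re) ∧ ‖e x‖ ≤ Fintype.card ι ∧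
        (∀ w, fiberSeminorm X a x w = 0 → e x w = 0) ∧
        ∀ w, ‖toFiber A x (comb v (w - e x w))‖ ≤ ε * ‖w‖ := by
  -- All four conditions are convex in `e`, so local solutions can be glued by a partition of unity.
  refine exists_continuous_forall_mem_convex_of_local (t := fun x =>
    {e : EuclideanSpace ℂ ι →L[ℂ] EuclideanSpace ℂ ι | (∀ w, 0 ≤ (inner ℂ w (e w)).re) ∧
      ‖e‖ ≤ Fintype.card ι ∧ (∀ w, fiberSeminorm X a x w = 0 → e w = 0) ∧
        ∀ w, ‖toFiber A x (comb v (w - e w))‖ ≤ ε * ‖w‖}) ?_ ?_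
  · rintro x e ⟨he1, he2, he3, he4⟩ f ⟨hf1, hf2, hf3, hf4⟩ α β hα hβ hαβ
    refine ⟨fun w => ?_, ?_, fun w hw => ?_, fun w => ?_⟩
    · have h1 := mul_nonneg hα (he1 w)
      have h2 := mul_nonneg hβ (hf1 w)
      simp only [add_apply, smul_apply, inner_add_right,
        inner_smul_right_eq_smul, Complex.add_re, Complex.real_smul, Complex.re_ofReal_mul]
      exact add_nonneg h1 h2
    · exact (convex_closedBall (0 : EuclideanSpace ℂ ι →L[ℂ] EuclideanSpace ℂ ι) _)
        |> fun h => mem_closedBall_zero_iff.1 (h (mem_closedBall_zero_iff.2 he2)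
          (mem_closedBall_zero_iff.2 hf2) hα hβ hαβ)
    · simp [he3 w hw, hf3 w hw]
    · have h1 : w - (α • e + β • f) w = (α : ℂ) • (w - e w) + (β : ℂ) • (w - f w) := by
        have : (α : ℂ) + β = 1 := by exact_mod_cast hαβ
        simp only [add_apply, smul_apply,
          ← Complex.coe_smul]
        have hw : w = (α : ℂ) • w + (β : ℂ) • w := by rw [← add_smul, this, one_smul]
        rw [smul_sub, smul_sub]
        nth_rewrite 1 [hw]
        abel
      rw [h1, map_add, map_add, map_smul, map_smul, map_smul, map_smul]
      refine (norm_add_le _ _).trans ?_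
      rw [norm_smul, norm_smul, Complex.norm_real, Complex.norm_real, Real.norm_of_nonneg hα,
        Real.norm_of_nonneg hβ]
      calc _ ≤ α * (ε * ‖w‖) + β * (ε * ‖w‖) := by gcongr; exacts [he4 w, hf4 w]
        _ = ε * ‖w‖ := by rw [← add_mul, hαβ, one_mul]
  · intro y
    obtain ⟨e, he1, he2, he3, he4⟩ := exists_continuous_projection (EuclideanSpace.basisFun ι ℂ)
      (continuous_fiberSeminorm hA a) y
    let u : ι → A := v - transform v e
    have hu (x : X) (w) : toFiber A x (comb u w) = toFiber A x (comb v (w - e x w)) := by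
      simp only [u]
      rw [comb_sub, map_sub, toFiber_comb_transform, ← map_sub, ← map_sub]
    have hη : 0 < ε / (Fintype.card ι + 1) := by positivity
    refine ⟨{x | ∀ i, ‖toFiber A x (u i)‖ < ε / (Fintype.card ι + 1)}, ?_, e,
      e.continuous.continuousOn, fun x hx => ⟨he1 x, he2 x, he3 x, fun w => ?_⟩⟩
    -- The error `u i` vanishes in the fibre at `y`, and continuity of the field keeps it small
    -- nearby.
    · refine Filter.eventually_all.2 fun i => ?_
      refine (hA (u i)).continuousAt.eventually_lt continuousAt_const ?_
      have := hu y (EuclideanSpace.single i 1)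
      rw [comb_single] at this
      rw [this, hv y _ (he4 _), norm_zero]
      exact hη
    · rw [← hu, comb_apply, map_sum]
      refine (norm_sum_le_of_le (n := fun _ => ‖w‖ * (ε / (Fintype.card ι + 1))) _
        fun i _ => ?_).trans ?_
      · rw [map_smul, norm_smul]
        exact mul_le_mul (PiLp.norm_apply_le w i) (hx i).le (norm_nonneg _) (norm_nonneg _)
      · rw [Finset.sum_const, Finset.card_univ, nsmul_eq_mul]
        have : (Fintype.card ι : ℝ) / (Fintype.card ι + 1) ≤ 1 :=
          (div_le_one (by positivity)).2 (by linarith)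
        calc _ = (Fintype.card ι : ℝ) / (Fintype.card ι + 1) * (ε * ‖w‖) := by ring
          _ ≤ 1 * (ε * ‖w‖) := by gcongr
          _ = _ := one_mul _

end Family

/-! ### Cohen factorization. -/

section Factorization

variable {ι : Type*} [Fintype ι] [CXAlgebra X A]

/-- `F` is a continuous family of operators bounded below by `c`, and equal to `c` on the vectors
`w` with `(∑ wᵢ aᵢ)_x = 0`. -/
def IsCoerciveFamily (a : ι → A) (c : ℝ)
    (F : C(X, EuclideanSpace ℂ ι →L[ℂ] EuclideanSpace ℂ ι)) : Prop :=
  ∀ x, (∀ w, c * ‖w‖ ^ 2 ≤ (inner ℂ w (F x w)).re) ∧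
    ∀ w, fiberSeminorm X a x w = 0 → F x w = (c : ℂ) • w

section

variable {a : ι → A} {c : ℝ} {F : C(X, EuclideanSpace ℂ ι →L[ℂ] EuclideanSpace ℂ ι)}

lemma IsCoerciveFamily.isUnit (hF : IsCoerciveFamily a c F) (hc : 0 < c) : IsUnit F :=
  (ContinuousMap.isUnit_iff_forall_isUnit F).2 fun x => isUnit_of_coercive hc (hF x).1

lemma IsCoerciveFamily.apply_inverse (hF : IsCoerciveFamily a c F) (hc : 0 < c) (x : X)
    (w : EuclideanSpace ℂ ι) : F x (Ring.inverse F x w) = w :=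
  congrArg (fun G : C(X, EuclideanSpace ℂ ι →L[ℂ] EuclideanSpace ℂ ι) => G x w)
    (Ring.mul_inverse_cancel F (hF.isUnit hc))

lemma IsCoerciveFamily.inverse_apply (hF : IsCoerciveFamily a c F) (hc : 0 < c) (x : X)
    (w : EuclideanSpace ℂ ι) : Ring.inverse F x (F x w) = w :=
  congrArg (fun G : C(X, EuclideanSpace ℂ ι →L[ℂ] EuclideanSpace ℂ ι) => G x w)
    (Ring.inverse_mul_cancel F (hF.isUnit hc))

lemma IsCoerciveFamily.mul_norm_inverse_le (hF : IsCoerciveFamily a c F) (hc : 0 < c) (x : X)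
    (w : EuclideanSpace ℂ ι) : c * ‖Ring.inverse F x w‖ ≤ ‖w‖ := by
  simpa only [hF.apply_inverse hc] using mul_norm_le_of_coercive (hF x).1 (Ring.inverse F x w)

lemma IsCoerciveFamily.inverse_apply_of_eq_zero (hF : IsCoerciveFamily a c F) (hc : 0 < c)
    {x : X} {w : EuclideanSpace ℂ ι} (hw : fiberSeminorm X a x w = 0) :
    Ring.inverse F x w = (c : ℂ)⁻¹ • w := by
  have h := hF.inverse_apply hc x w
  rw [(hF x).2 w hw, map_smul] at h
  rw [← h, smul_smul, inv_mul_cancel₀ (by exact_mod_cast hc.ne'), one_smul, h]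

end

variable [DecidableEq ι]

lemma continuous_act_uncurry [CompactSpace X] : Continuous fun q : C(X, ℂ) × A => act q.1 q.2 := by
  let f := (actBilin X A).mkContinuous₂ 1 fun f a => by
    rw [one_mul]; exact norm_act_le f a
  exact f.continuous₂

lemma continuous_entry (i j : ι) :
    Continuous fun F : C(X, EuclideanSpace ℂ ι →L[ℂ] EuclideanSpace ℂ ι) => entry F i j := by
  let g : C(EuclideanSpace ℂ ι →L[ℂ] EuclideanSpace ℂ ι, ℂ) :=
    ⟨fun T => T (EuclideanSpace.single i 1) j, by fun_prop⟩
  exact g.continuous_postcomp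

lemma continuous_transform [CompactSpace X] : Continuous
    fun q : (ι → A) × C(X, EuclideanSpace ℂ ι →L[ℂ] EuclideanSpace ℂ ι) => transform q.1 q.2 := by
  refine continuous_pi fun i => continuous_finsetSum _ fun j _ => ?_
  exact continuous_act_uncurry.comp
    (((continuous_entry i j).comp continuous_snd).prodMk ((continuous_apply j).comp continuous_fst))

variable [CompactSpace X] [T2Space X]

/-- Take `F' = F - (c/2)(1 - e)`: positivity of `e` keeps the lower bound `c/2`, and `e = 0` on
relations gives exactly `c/2` there. Since `e` almost fixes `a F⁻¹`, replacing `F⁻¹` by `F'⁻¹`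
changes this family little, although `F'⁻¹` itself may grow. -/
lemma IsCoerciveFamily.exists_next (hA : IsContinuousField X A) {a : ι → A} {c : ℝ}
    {F : C(X, EuclideanSpace ℂ ι →L[ℂ] EuclideanSpace ℂ ι)} (hF : IsCoerciveFamily a c F)
    (hc : 0 < c) {ε : ℝ} (hε : 0 < ε) :
    ∃ F' : C(X, EuclideanSpace ℂ ι →L[ℂ] EuclideanSpace ℂ ι), IsCoerciveFamily a (c / 2) F' ∧
      dist F F' ≤ c * (1 + Fintype.card ι) ∧
      dist (transform a (Ring.inverse F)) (transform a (Ring.inverse F')) ≤ ε := by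
  obtain ⟨e, he⟩ := exists_approximate_unit hA (a := a) (v := transform a (Ring.inverse F))
    (fun x w hw => by
      rw [toFiber_comb_transform, hF.inverse_apply_of_eq_zero hc hw, map_smul, map_smul,
        toFiber_comb_eq_zero hw, smul_zero]) hε
  let F' : C(X, EuclideanSpace ℂ ι →L[ℂ] EuclideanSpace ℂ ι) :=
    F - ((c / 2 : ℝ) : ℂ) • (1 - e)
  have hF'x (x : X) (w) : F' x w = F x w - ((c / 2 : ℝ) : ℂ) • (w - e x w) := rfl
  have hco : IsCoerciveFamily a (c / 2) F' := by
    refine fun x => ⟨fun w => ?_, fun w hw => ?_⟩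
    · have h1 := (hF x).1 w
      have h2 := mul_nonneg hc.le ((he x).1 w)
      have h3 : (inner ℂ w w).re = ‖w‖ ^ 2 := inner_self_eq_norm_sq (𝕜 := ℂ) w
      rw [hF'x, inner_sub_right, inner_smul_right, inner_sub_right, Complex.sub_re,
        Complex.re_ofReal_mul, Complex.sub_re, h3]
      linarith
    · rw [hF'x, (hF x).2 w hw, (he x).2.2.1 w hw, sub_zero, ← sub_smul]
      congr 1
      push_cast
      ring
  have hc2 := half_pos hc
  refine ⟨F', hco, ?_, ?_⟩
  · refine (ContinuousMap.dist_le (by positivity)).2 fun x => ?_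
    have h1 : F x - F' x = ((c / 2 : ℝ) : ℂ) • (1 - e x) := sub_sub_cancel _ _
    have h2 : ‖1 - e x‖ ≤ 1 + Fintype.card ι :=
      (norm_sub_le _ _).trans (add_le_add ContinuousLinearMap.norm_id_le (he x).2.1)
    rw [dist_eq_norm, h1, norm_smul, Complex.norm_real, Real.norm_of_nonneg hc2.le]
    calc _ ≤ c / 2 * (1 + Fintype.card ι) := by gcongr
      _ ≤ _ := by gcongr; linarith
  · rw [dist_eq_norm, norm_sub_rev]
    refine norm_le_of_toFiber_comb (X := X) hε.le fun x w => ?_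
    set u := ((c / 2 : ℝ) : ℂ) • Ring.inverse F' x w with hu
    have hun : ‖u‖ ≤ ‖w‖ := by
      rw [hu, norm_smul, Complex.norm_real, Real.norm_of_nonneg hc2.le]
      exact hco.mul_norm_inverse_le hc2 x w
    -- The resolvent identity, with the factor `c/2` absorbed into `u` so that `‖u‖ ≤ ‖w‖`.
    have key : Ring.inverse F' x w - Ring.inverse F x w = Ring.inverse F x (u - e x u) := by
      have h1 : F x (Ring.inverse F' x w) - w = u - e x u := by
        have h2 := hco.apply_inverse hc2 x w
        rw [hF'x] at h2
        nth_rewrite 2 [← h2]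
        rw [sub_sub_cancel, smul_sub, hu, map_smul]
      rw [← h1, map_sub, hF.inverse_apply hc]
    rw [comb_sub, map_sub, toFiber_comb_transform, toFiber_comb_transform, ← map_sub, ← map_sub,
      key, ← toFiber_comb_transform]
    exact ((he x).2.2.2 u).trans (by gcongr)

/-- A finite family in a continuous field factors through a continuous family of operators
vanishing on its fibrewise linear relations. -/
theorem exists_factorization (hA : IsContinuousField X A) (a : ι → A) :
    ∃ (v : ι → A) (F : C(X, EuclideanSpace ℂ ι →L[ℂ] EuclideanSpace ℂ ι)),
      transform v F = a ∧ ∀ x w, toFiber A x (comb a w) = 0 → F x w = 0 := by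
  have hpos (n : ℕ) : (0 : ℝ) < 1 / 2 ^ n := by positivity
  choose! next hn1 hn2 hn3 using fun (n : ℕ)
      (F : C(X, EuclideanSpace ℂ ι →L[ℂ] EuclideanSpace ℂ ι))
      (hF : IsCoerciveFamily a (1 / 2 ^ n) F) => hF.exists_next hA (hpos n) (hpos n)
  let F : ℕ → C(X, EuclideanSpace ℂ ι →L[ℂ] EuclideanSpace ℂ ι) := fun n =>
    Nat.rec 1 (fun n F => next n F) n
  have hF (n : ℕ) : IsCoerciveFamily a (1 / 2 ^ n) (F n) := by
    induction n with
    | zero =>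
      intro x
      refine ⟨fun w => ?_, fun w _ => ?_⟩
      · rw [pow_zero, div_one, one_mul]
        exact (inner_self_eq_norm_sq (𝕜 := ℂ) w).ge
      · simp [F]
    | succ n ih =>
      have := hn1 n (F n) ih
      rwa [div_div, ← pow_succ] at this
  obtain ⟨F₀, hF₀⟩ := cauchySeq_tendsto_of_complete
    (cauchySeq_of_le_geometric (1 / 2) (1 + Fintype.card ι) (by norm_num) fun n => by
      rw [one_div_pow, mul_comm]
      exact hn2 n (F n) (hF n))
  obtain ⟨v, hv⟩ := cauchySeq_tendsto_of_complete
    (cauchySeq_of_le_geometric (f := fun n => transform a (Ring.inverse (F n))) (1 / 2) 1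
      (by norm_num) fun n => by
        rw [one_div_pow, one_mul]
        exact hn3 n (F n) (hF n))
  refine ⟨v, F₀, ?_, fun x w hw => ?_⟩
  · have h1 := (continuous_transform.tendsto (v, F₀)).comp (hv.prodMk_nhds hF₀)
    refine tendsto_nhds_unique h1 ?_
    -- The factorization is exact at every stage and passes to the limit by joint continuity of
    -- `transform`.
    have h2 (n : ℕ) : transform (transform a (Ring.inverse (F n))) (F n) = a :=
      ext_toFiber_comb (X := X) fun x w => by
        rw [toFiber_comb_transform, toFiber_comb_transform, (hF n).inverse_apply (hpos n)]
    simp only [Function.comp_def, h2]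
    exact tendsto_const_nhds
  · have hw' : fiberSeminorm X a x w = 0 := by rw [fiberSeminorm_apply, hw, norm_zero]
    have h1 : Filter.Tendsto (fun n => F n x w) Filter.atTop (nhds (F₀ x w)) := by
      have : Continuous fun G : C(X, EuclideanSpace ℂ ι →L[ℂ] EuclideanSpace ℂ ι) => G x w := by
        fun_prop
      exact (this.tendsto F₀).comp hF₀
    refine tendsto_nhds_unique h1 ?_
    simp only [((hF _) x).2 w hw']
    have h2 : Filter.Tendsto (fun n : ℕ => ((1 / 2 ^ n : ℝ) : ℂ)) Filter.atTop (nhds 0) := by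
      have := tendsto_pow_atTop_nhds_zero_of_lt_one (r := (1 / 2 : ℝ)) (by norm_num) (by norm_num)
      simp only [one_div_pow] at this
      exact_mod_cast (Complex.continuous_ofReal.tendsto 0).comp this
    simpa using h2.smul_const w

end Factorization

/-- A relation `∑ T wᵢ ⊗ bᵢ = 0` is transported by every linear form that vanishes on the kernel
of `T`. -/
lemma sum_apply_smul_eq_zero {ι E V W : Type*} [Fintype ι] [AddCommGroup E] [Module ℂ E]
    [AddCommGroup V] [Module ℂ V] [AddCommGroup W] [Module ℂ W] {T : E →ₗ[ℂ] V} {φ : E →ₗ[ℂ] ℂ}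
    (hφ : LinearMap.ker T ≤ LinearMap.ker φ) {w : ι → E} {b : ι → W}
    (h : ∑ i, T (w i) ⊗ₜ[ℂ] b i = 0) : ∑ i, φ (w i) • b i = 0 := by
  -- `φ` descends to `E / ker T`, which embeds in `V` with a linear retraction `g`.
  obtain ⟨ψ, rfl⟩ : ∃ ψ : V →ₗ[ℂ] ℂ, ψ ∘ₗ T = φ := by
    have hinj : LinearMap.ker ((LinearMap.ker T).liftQ T le_rfl) = ⊥ :=
      Submodule.ker_liftQ_eq_bot _ _ _ le_rfl
    obtain ⟨g, hg⟩ := LinearMap.exists_leftInverse_of_injective _ hinj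
    refine ⟨(LinearMap.ker T).liftQ φ hφ ∘ₗ g, LinearMap.ext fun e => ?_⟩
    have := LinearMap.congr_fun hg ((LinearMap.ker T).mkQ e)
    simp only [LinearMap.comp_apply, Submodule.mkQ_apply, Submodule.liftQ_apply,
      LinearMap.id_apply] at this ⊢
    rw [this, Submodule.liftQ_apply]
  have := congrArg ((TensorProduct.lid ℂ W).toLinearMap ∘ₗ TensorProduct.map ψ LinearMap.id) h
  simpa using this

/-! ### Elements vanishing in every fibre are balanced. -/

section Main

variable [CXAlgebra X A] [CXAlgebra X B] [CompactSpace X] [T2Space X]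

theorem idealJ_le_balancedSpan (hA : IsContinuousField X A) :
    idealJ X A B ≤ balancedSpan X A B := by
  classical
  intro t ht
  obtain ⟨S, rfl⟩ := TensorProduct.exists_finset t
  let a : S → A := fun i => i.1.1
  let b : S → B := fun i => i.1.2
  have hS : ∑ i ∈ S, i.1 ⊗ₜ[ℂ] i.2 = ∑ i : S, a i ⊗ₜ[ℂ] b i :=
    (Finset.sum_coe_sort S fun i => i.1 ⊗ₜ[ℂ] i.2).symm
  rw [hS] at ht ⊢
  obtain ⟨v, F, hvF, hF⟩ := exists_factorization hA a
  have hzero (j : S) : ∑ i, act (entry F i j) (b i) = 0 := by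
    refine eq_zero_of_forall_toFiber (X := X) fun x => ?_
    simp only [map_sum, toFiber_act, entry_apply]
    have hx : ∑ i, toFiber A x (a i) ⊗ₜ[ℂ] toFiber B x (b i) = 0 := by
      simpa using (Submodule.mem_iInf _).1 ht x
    -- The `j`-th coordinate of `F x` kills the relations among the `(aᵢ)_x`, so it can be applied
    -- to the first tensor factor.
    refine sum_apply_smul_eq_zero (T := toFiber A x ∘ₗ comb a)
      (φ := (EuclideanSpace.proj j ∘L F x : EuclideanSpace ℂ S →L[ℂ] ℂ))
      (w := fun i => EuclideanSpace.single i 1) (fun w hw => ?_) ?_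
    · have := hF x w hw
      simp [this]
    · simpa only [LinearMap.comp_apply, comb_single] using hx
  have hsum : ∑ i, a i ⊗ₜ[ℂ] b i = ∑ i, ∑ j,
      (act (entry F i j) (v j) ⊗ₜ[ℂ] b i - v j ⊗ₜ[ℂ] act (entry F i j) (b i)) := by
    simp only [Finset.sum_sub_distrib]
    rw [Finset.sum_comm (f := fun i j => v j ⊗ₜ[ℂ] act (entry F i j) (b i))]
    simp only [← TensorProduct.tmul_sum, hzero, TensorProduct.tmul_zero, Finset.sum_const_zero,
      sub_zero, ← TensorProduct.sum_tmul]
    rw [← hvF]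
    rfl
  rw [hsum]
  exact sum_mem fun i _ => sum_mem fun j _ => act_tmul_sub_mem _ _ _

end Main

end

end CXAlgebra

theorem mainTheorem3 {X A B : Type*} [TopologicalSpace X] [CompactSpace X] [T2Space X]
    [NonUnitalCStarAlgebra A] [NonUnitalCStarAlgebra B] [CXAlgebra X A] [CXAlgebra X B]
    (hA : CXAlgebra.IsContinuousField X A) :
    CXAlgebra.idealI X A B = CXAlgebra.idealJ X A B := by
  rw [CXAlgebra.idealI_eq_balancedSpan]
  exact le_antisymm CXAlgebra.balancedSpan_le_idealJ (CXAlgebra.idealJ_le_balancedSpan hA)
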